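/- Let $a,b,c,s,t\in(0,1)$ with $a<s$. Then there exists a metric space $(L,d)$ with exactly six points that satisfies the following two conditions. (i) $L$ satisfies every Andoni–Naor–Neiman inequality. That is, let $m,n$ be positive integers, let $c_1,\dots,c_m$ be positive real numbers, for every $k\in\{1,\dots,m\}$ let $p_1^k,\dots,p_n^k,q_1^k,\dots,q_n^k$ be positive real numbers with $\sum_{i=1}^n p_i^k=\sum_{j=1}^n q_j^k=1$, and let $A_k=(a_{ij}^k)$ and $B_k=(b_{ij}^k)$ be $n\times n$ matrices with nonnegative real entries such that $$\sum_{r=1}^n a_{ir}^k+\sum_{r=1}^n b_{rj}^k=p_i^k+q_j^k\qquad\text{for all } i,j\in\{1,\dots,n\}.$$ Then for all (not necessarily distinct) points $x_1,\dots,x_n\in L$, $$\sum_{k=1}^m\ \sum_{\substack{1\le i,j\le n\\ a_{ij}^k+b_{ij}^k>0}}\frac{c_k\,a_{ij}^k\,b_{ij}^k}{a_{ij}^k+b_{ij}^k}\,d(x_i,x_j)^2\ \le\ \sum_{k=1}^m\sum_{i=1}^n\sum_{j=1}^n c_k\,p_i^k\,q_j^k\,d(x_i,x_j)^2 .$$ (ii)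 $L$ does not satisfy the six-point inequality with parameters $a,b,c,s,t$. That is, it is not true that for all $x_0,x_1,y_0,y_1,z_0,z_1\in L$ $$\begin{aligned} &sta\big((1-t)(1-a)+(1-s)tb\big)\,d(x_0,x_1)^2+s(1-t)t(1-b)b\,d(y_0,y_1)^2+ab(1-c)c\,d(z_0,z_1)^2\\ &\quad\le (1-s)tab(1-c)\,d(x_0,z_0)^2+stab(1-c)\,d(x_1,z_0)^2+(1-t)ab(1-c)\,d(y_1,z_0)^2\\ &\qquad+(1-s)tabc\,d(x_0,z_1)^2+stabc\,d(x_1,z_1)^2+(1-t)abc\,d(y_1,z_1)^2\\ &\qquad+s(1-t)t(1-a)(1-b)\,d(x_0,y_0)^2+s(1-t)ta(1-b)\,d(x_1,y_0)^2+(1-t)t(s-a)b\,d(x_0,y_1)^2 . \end{aligned}$$ -/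

import Mathlib

/-- `X` satisfies every Andoni–Naor–Neiman inequality: for all positive integers `m`, `n`, all
admissible weights `c k`, `p k i`, `q k j` and matrices `A k`, `B k`, and all points
`x 1, …, x n` of `X` (not necessarily distinct). -/
def SatisfiesANNInequalities (X : Type*) [MetricSpace X] : Prop :=
  ∀ (m n : ℕ), 0 < m → 0 < n →
  ∀ (c : Fin m → ℝ) (p q : Fin m → Fin n → ℝ) (A B : Fin m → Matrix (Fin n) (Fin n) ℝ),
    (∀ k, 0 < c k) →
    (∀ k i, 0 < p k i) →
    (∀ k j, 0 < q k j) →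
    (∀ k, ∑ i, p k i = 1) →
    (∀ k, ∑ j, q k j = 1) →
    (∀ k i j, 0 ≤ A k i j) →
    (∀ k i j, 0 ≤ B k i j) →
    (∀ k i j, ∑ r, A k i r + ∑ r, B k r j = p k i + q k j) →
  ∀ x : Fin n → X,
    ∑ k, ∑ ij : Fin n × Fin n with 0 < A k ij.1 ij.2 + B k ij.1 ij.2,
        c k * A k ij.1 ij.2 * B k ij.1 ij.2 / (A k ij.1 ij.2 + B k ij.1 ij.2)
          * dist (x ij.1) (x ij.2) ^ 2
      ≤ ∑ k, ∑ i, ∑ j, c k * p k i * q k j * dist (x i) (x j) ^ 2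

/-- `X` satisfies the six-point inequality with parameters `a, b, c, s, t`, i.e. the inequality
holds for all choices of six points of `X`. -/
def SatisfiesSixPointInequality (X : Type*) [MetricSpace X] (a b c s t : ℝ) : Prop :=
  ∀ x₀ x₁ y₀ y₁ z₀ z₁ : X,
    s * t * a * ((1 - t) * (1 - a) + (1 - s) * t * b) * dist x₀ x₁ ^ 2
      + s * (1 - t) * t * (1 - b) * b * dist y₀ y₁ ^ 2
      + a * b * (1 - c) * c * dist z₀ z₁ ^ 2
    ≤ (1 - s) * t * a * b * (1 - c) * dist x₀ z₀ ^ 2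
      + s * t * a * b * (1 - c) * dist x₁ z₀ ^ 2
      + (1 - t) * a * b * (1 - c) * dist y₁ z₀ ^ 2
      + (1 - s) * t * a * b * c * dist x₀ z₁ ^ 2
      + s * t * a * b * c * dist x₁ z₁ ^ 2
      + (1 - t) * a * b * c * dist y₁ z₁ ^ 2
      + s * (1 - t) * t * (1 - a) * (1 - b) * dist x₀ y₀ ^ 2
      + s * (1 - t) * t * a * (1 - b) * dist x₁ y₀ ^ 2
      + (1 - t) * t * (s - a) * b * dist x₀ y₁ ^ 2

/-!
The six-point inequality is the sum of two inequalities in which the terms in `d(x₁, y₁)²` cancel.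
One is the quadrilateral inequality for `x₀, y₀, x₁, y₁`, an equality when these points are the
vertices of a plane quadrilateral whose diagonals divide each other in the ratios given by `a`
and `b`. The other compares `z₀, z₁` with `x₀, x₁, y₁`, and is an equality when the segment `z₀z₁`
meets the plane of the quadrilateral in the point `o = (1 - t) y₁ + t ((1 - s) x₀ + s x₁)`. Starting
from this configuration in `ℝ³`, with `z₀z₁` orthogonal to the plane, lower the squared distances
between the quadrilateral and `z₀, z₁` by a small `τ²` and keep all the others. The six-point
inequality then fails by exactly `a b τ²`.

The Andoni–Naor–Neiman inequalities survive because they need much less than a nonpositively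
curved space around the six points. It is enough that each probability vector `p` on the points has
a virtual barycenter: numbers `f i ≥ 0` with `d i j ≤ f i + f j` and
`f j ² + ∑ p i f i ² ≤ ∑ p i d i j ²` (`HasVirtualBarycenters`,
`satisfiesANNInequalities_of_hasVirtualBarycenters`). These numbers may depend on `p`, and need not
come from one ambient space. Point masses `p` give the triangle inequality.

To find them, regard the lowered distances as those of points in `ℝ³` with an additional time
coordinate, `1` on the quadrilateral and `0` on `z₀, z₁`, entering the squared distance as
`-τ² (time difference)²`. The barycenter in this Lorentzian space satisfies the variance
inequality with equality, and the domination `d i j ≤ f i + f j` for the pair `i, j` fails only near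
the segment `ij`. It is never a problem between a vertex and a `z`, because the vertices are on the
boundary of a convex hull that contains `o` in its interior (`joinSegment_bound`). For `z₀, z₁` the
trouble is at barycenters near the line `z₀z₁`, and there all distances to the vertices have room to
be decreased, because `o` lies on no side or diagonal; for two vertices the trouble is near the
plane and away from `o`, and there the distances to `z₀, z₁` have room. These two corrections are made in `exists_joinCorrection`, and `hasVirtualBarycenters_join` combines them
with the variance identity.
-/

open scoped Topology

/-! ### Virtual barycenters and the Andoni–Naor–Neiman inequalities -/

/-- `D`, thought of as a squared distance, admits virtual barycenters: each probability vector `p`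
has a vector `u` of would-be squared distances to a barycenter of `p`. The first condition on `u`
says `√D i j ≤ √u i + √u j`, written without square roots; the second is the variance inequality
of nonpositive curvature. Taking `i = j` shows that `u` is nonnegative. -/
def HasVirtualBarycenters {ι : Type*} [Fintype ι] (D : ι → ι → ℝ) : Prop :=
  ∀ p : ι → ℝ, (∀ i, 0 ≤ p i) → ∑ i, p i = 1 → ∃ u : ι → ℝ,
    (∀ i j, ∀ κ ∈ Set.Icc (0 : ℝ) 1, κ * (1 - κ) * D i j ≤ κ * u i + (1 - κ) * u j) ∧
    ∀ j, u j + ∑ i, p i * u i ≤ ∑ i, p i * D i j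

theorem HasVirtualBarycenters.pushforward {ι : Type*} [Fintype ι] {D : ι → ι → ℝ}
    (hD : HasVirtualBarycenters D) {α : Type*} [Fintype α] (x : α → ι) (p : α → ℝ)
    (hp : ∀ i, 0 ≤ p i) (hp1 : ∑ i, p i = 1) : ∃ u : ι → ℝ,
    (∀ i j, ∀ κ ∈ Set.Icc (0 : ℝ) 1, κ * (1 - κ) * D i j ≤ κ * u i + (1 - κ) * u j) ∧
    ∀ j, u j + ∑ i, p i * u (x i) ≤ ∑ i, p i * D (x i) j := by
  classical
  have push : ∀ F : ι → ℝ, ∑ l, (∑ i with x i = l, p i) * F l = ∑ i, p i * F (x i) := by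
    intro F
    rw [← Finset.sum_fiberwise Finset.univ x]
    refine Finset.sum_congr rfl fun l _ => ?_
    rw [Finset.sum_mul]
    refine Finset.sum_congr rfl fun i hi => ?_
    rw [(Finset.mem_filter.1 hi).2]
  obtain ⟨u, h1, h2⟩ := hD (fun l => ∑ i with x i = l, p i)
    (fun l => Finset.sum_nonneg fun i _ => hp i) (by simpa [hp1] using push fun _ => 1)
  refine ⟨u, h1, fun j => ?_⟩
  have := h2 j
  rwa [push u, push fun l => D l j] at this

theorem satisfiesANNInequalities_of_hasVirtualBarycenters {X : Type*} [MetricSpace X] [Fintype X]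
    {D : X → X → ℝ} (hD : HasVirtualBarycenters D) (hdist : ∀ x y, dist x y ^ 2 = D x y) :
    SatisfiesANNInequalities X := by
  intro m n _ _ c p q A B hc hp hq hp1 hq1 hA hB hAB x
  refine Finset.sum_le_sum fun k _ => ?_
  obtain ⟨u, h1, h2⟩ := hD.pushforward x (p k) (fun i => (hp k i).le) (hp1 k)
  have hu : ∀ y, 0 ≤ u y := fun y => by simpa using h1 y y 1 (by simp)
  have hterm : ∀ ij : Fin n × Fin n, 0 < A k ij.1 ij.2 + B k ij.1 ij.2 →
      c k * A k ij.1 ij.2 * B k ij.1 ij.2 / (A k ij.1 ij.2 + B k ij.1 ij.2)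
          * dist (x ij.1) (x ij.2) ^ 2
        ≤ c k * (A k ij.1 ij.2 * u (x ij.1) + B k ij.1 ij.2 * u (x ij.2)) := by
    rintro ⟨i, j⟩ hpos
    simp only at hpos ⊢
    set α := A k i j
    set β := B k i j
    have hα : 0 ≤ α := hA k i j
    have hβ : 0 ≤ β := hB k i j
    have h := h1 (x i) (x j) (α / (α + β))
      ⟨by positivity, (div_le_one hpos).2 (by linarith)⟩
    have h1' : 1 - α / (α + β) = β / (α + β) := by field_simp; ring
    rw [h1'] at h
    rw [hdist]
    calc c k * α * β / (α + β) * D (x i) (x j)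
        = c k * (α + β) * (α / (α + β) * (β / (α + β)) * D (x i) (x j)) := by field_simp
      _ ≤ c k * (α + β) * (α / (α + β) * u (x i) + β / (α + β) * u (x j)) :=
          mul_le_mul_of_nonneg_left h (mul_nonneg (hc k).le hpos.le)
      _ = c k * (α * u (x i) + β * u (x j)) := by field_simp
  calc _ ≤ ∑ ij : Fin n × Fin n with 0 < A k ij.1 ij.2 + B k ij.1 ij.2,
        c k * (A k ij.1 ij.2 * u (x ij.1) + B k ij.1 ij.2 * u (x ij.2)) :=
        Finset.sum_le_sum fun ij hij => hterm ij (Finset.mem_filter.1 hij).2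
    _ ≤ ∑ ij : Fin n × Fin n,
        c k * (A k ij.1 ij.2 * u (x ij.1) + B k ij.1 ij.2 * u (x ij.2)) := by
        refine Finset.sum_le_sum_of_subset_of_nonneg (Finset.filter_subset _ _) fun ij _ _ => ?_
        exact mul_nonneg (hc k).le (add_nonneg (mul_nonneg (hA k _ _) (hu _))
          (mul_nonneg (hB k _ _) (hu _)))
    -- only the diagonal instances of the condition on row and column sums matter
    _ = c k * ∑ i, (p k i + q k i) * u (x i) := by
        rw [← Finset.mul_sum, Fintype.sum_prod_type]
        simp only [Finset.sum_add_distrib]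
        rw [Finset.sum_comm (f := fun i j => B k i j * u (x j)), ← Finset.sum_add_distrib]
        congr 1
        refine Finset.sum_congr rfl fun i _ => ?_
        rw [← hAB k i i, add_mul, Finset.sum_mul, Finset.sum_mul]
    _ = c k * ∑ j, q k j * (u (x j) + ∑ i, p k i * u (x i)) := by
        congr 1
        simp only [mul_add, add_mul, Finset.sum_add_distrib, ← Finset.sum_mul, hq1 k]
        ring
    _ ≤ c k * ∑ j, q k j * ∑ i, p k i * D (x i) (x j) :=
        mul_le_mul_of_nonneg_left (Finset.sum_le_sum fun j _ =>
          mul_le_mul_of_nonneg_left (h2 _) (hq k j).le) (hc k).le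
    _ = _ := by
        simp only [Finset.mul_sum]
        rw [Finset.sum_comm]
        refine Finset.sum_congr rfl fun i _ => Finset.sum_congr rfl fun j _ => ?_
        rw [hdist]; ring

/-- The triangle inequality for `√D` is the case of point masses in `HasVirtualBarycenters D`. -/
theorem HasVirtualBarycenters.exists_metricSpace {ι : Type*} [Fintype ι] {D : ι → ι → ℝ}
    (hD : HasVirtualBarycenters D) (hself : ∀ i, D i i = 0) (hsymm : ∀ i j, D i j = D j i)
    (hpos : ∀ i j, i ≠ j → 0 < D i j) :
    ∃ _ : MetricSpace ι, ∀ i j, dist i j ^ 2 = D i j := by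
  classical
  have hnn : ∀ i j, 0 ≤ D i j := fun i j => by
    rcases eq_or_ne i j with rfl | h
    · exact (hself i).ge
    · exact (hpos i j h).le
  have htri : ∀ i j k, √(D i k) ≤ √(D i j) + √(D j k) := by
    intro i j k
    rcases eq_or_ne i j with rfl | hij
    · simp [hself]
    rcases eq_or_ne j k with rfl | hjk
    · simp [hself]
    obtain ⟨u, h1, h2⟩ := hD.pushforward (fun _ : Unit => j) (fun _ => 1) (by simp) (by simp)
    simp only [Finset.univ_unique, Finset.sum_const, Finset.card_singleton, one_smul, one_mul]
      at h2
    have hj : 0 ≤ u j := by simpa using h1 j j 1 (by simp)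
    have hui : u i ≤ D i j := by linarith [h2 i, hsymm i j]
    have huk : u k ≤ D j k := by linarith [h2 k]
    set P := √(D i j) with hP
    set Q := √(D j k) with hQ
    have hP0 : 0 < P := Real.sqrt_pos.2 (hpos i j hij)
    have hQ0 : 0 < Q := Real.sqrt_pos.2 (hpos j k hjk)
    have hP2 : D i j = P ^ 2 := (Real.sq_sqrt (hnn i j)).symm
    have hQ2 : D j k = Q ^ 2 := (Real.sq_sqrt (hnn j k)).symm
    have hS : 0 < P + Q := by positivity
    have h := h1 i k (Q / (P + Q)) ⟨by positivity, (div_le_one hS).2 (by linarith)⟩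
    have h1' : 1 - Q / (P + Q) = P / (P + Q) := by field_simp; ring
    rw [h1'] at h
    have h3 : Q / (P + Q) * (P / (P + Q)) * D i k ≤
        Q / (P + Q) * P ^ 2 + P / (P + Q) * Q ^ 2 := by
      refine h.trans (add_le_add ?_ ?_) <;> refine mul_le_mul_of_nonneg_left ?_ (by positivity)
      · linarith
      · linarith
    have h4 : Q / (P + Q) * P ^ 2 + P / (P + Q) * Q ^ 2 =
        Q / (P + Q) * (P / (P + Q)) * (P + Q) ^ 2 := by field_simp
    rw [h4] at h3
    exact Real.sqrt_le_left hS.le |>.2 (le_of_mul_le_mul_left h3 (by positivity))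
  refine ⟨{ dist := fun i j => √(D i j)
            dist_self := fun i => by simp [hself]
            dist_comm := fun i j => by simp [hsymm i j]
            dist_triangle := htri
            eq_of_dist_eq_zero := fun {i j} h => ?_ }, fun i j => Real.sq_sqrt (hnn i j)⟩
  by_contra hij
  exact (Real.sqrt_pos.2 (hpos i j hij)).ne' h

/-! ### The perturbed orthogonal join of two configurations -/

section Join

variable {E F I J : Type*} [NormedAddCommGroup E] [InnerProductSpace ℝ E] [NormedAddCommGroup F]
  [InnerProductSpace ℝ F]

/-- Squared distances for the points `v i` and `h j` placed in the orthogonal subspaces `E` and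
`F` of `E × F`, except that every squared distance between a `v i` and an `h j` is lowered by
`τ ^ 2`. -/
def joinSqDist (v : I → E) (h : J → F) (τ : ℝ) : I ⊕ J → I ⊕ J → ℝ
  | .inl i, .inl i' => ‖v i - v i'‖ ^ 2
  | .inl i, .inr j => ‖v i‖ ^ 2 + ‖h j‖ ^ 2 - τ ^ 2
  | .inr j, .inl i => ‖v i‖ ^ 2 + ‖h j‖ ^ 2 - τ ^ 2
  | .inr j, .inr j' => ‖h j - h j'‖ ^ 2

/-- Each `v i` keeps a definite distance from the convex hull of the configuration contracted
towards the origin by a factor `m < 1`. For small `τ > 0` this holds when the origin is interior to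
the hull and the `v i` are on its boundary. -/
def IsSupported (v : I → E) (τ : ℝ) : Prop :=
  ∀ i, ∀ w ∈ convexHull ℝ (Set.range v), ∀ m ∈ Set.Icc (0 : ℝ) 1, 3 * τ * (1 - m) ≤ ‖v i - m • w‖

theorem IsSupported.le_norm {v : I → E} {τ : ℝ} (hv : IsSupported v τ) (i : I) :
    3 * τ ≤ ‖v i‖ := by
  simpa using hv i (v i) (subset_convexHull ℝ _ ⟨i, rfl⟩) 0 (by simp)

theorem IsSupported.mul_sub_le_norm {v : I → E} {τ : ℝ} (hτ : 0 ≤ τ) (hv : IsSupported v τ)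
    (i : I) {w : E} (hw : w ∈ convexHull ℝ (Set.range v)) {m κ : ℝ} (hm : 0 ≤ m) (hκ : 0 ≤ κ) :
    3 * τ * (κ - m) ≤ ‖κ • v i - m • w‖ := by
  rcases le_or_gt κ m with h | h
  · exact (mul_nonpos_of_nonneg_of_nonpos (by positivity) (by linarith)).trans (norm_nonneg _)
  have hκ' : 0 < κ := hm.trans_lt h
  have h1 := hv i w hw (m / κ) ⟨by positivity, (div_le_one hκ').2 h.le⟩
  have h2 : κ • v i - m • w = κ • (v i - (m / κ) • w) := by
    rw [smul_sub, smul_smul, mul_div_cancel₀ _ hκ'.ne']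
  rw [h2, norm_smul, Real.norm_of_nonneg hκ]
  calc 3 * τ * (κ - m) = κ * (3 * τ * (1 - m / κ)) := by field_simp
    _ ≤ _ := mul_le_mul_of_nonneg_left h1 hκ

/-- If all weights vanish, any point of the hull serves as `w`. -/
theorem exists_smul_eq_sum_of_nonneg [Fintype I] [Nonempty I] (v : I → E) {p : I → ℝ}
    (hp : ∀ i, 0 ≤ p i) :
    ∃ w ∈ convexHull ℝ (Set.range v), ∑ i, p i • v i = (∑ i, p i) • w := by
  rcases (Finset.sum_nonneg fun i _ => hp i : 0 ≤ ∑ i, p i).eq_or_lt' with h | h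
  · obtain ⟨i⟩ := ‹Nonempty I›
    refine ⟨v i, subset_convexHull ℝ _ ⟨i, rfl⟩, ?_⟩
    have := (Finset.sum_eq_zero_iff_of_nonneg fun i _ => hp i).1 h
    rw [h, zero_smul]
    exact Finset.sum_eq_zero fun i hi => by rw [this i hi, zero_smul]
  · refine ⟨Finset.univ.centerMass p v, Finset.centerMass_mem_convexHull _ (fun i _ => hp i) h
      fun i _ => ⟨i, rfl⟩, ?_⟩
    rw [Finset.centerMass, smul_smul, mul_inv_cancel₀ h.ne', one_smul]

/-- The separation between a barycenter `(m • w, (1 - m) • z)` of the join and the point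
`(κ • v i, (1 - κ) • h j)` of a segment between the two configurations. The first bound makes the
Lorentzian squared distance, with time coordinates `m` and `κ`, nonnegative. -/
theorem joinSegment_bound {v : I → E} {h : J → F} {τ : ℝ} (hτ : 0 ≤ τ) (hv : IsSupported v τ)
    (hh : IsSupported h τ) {w : E} (hw : w ∈ convexHull ℝ (Set.range v)) {z : F}
    (hz : z ∈ convexHull ℝ (Set.range h)) {m κ : ℝ} (hm : m ∈ Set.Icc (0 : ℝ) 1)
    (hκ : κ ∈ Set.Icc (0 : ℝ) 1) (i : I) (j : J) :
    τ ^ 2 * (m - κ) ^ 2 ≤ ‖κ • v i - m • w‖ ^ 2 + ‖(1 - κ) • h j - (1 - m) • z‖ ^ 2 ∧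
    (‖w‖ < τ → τ ^ 2 * κ ^ 2 ≤
      ‖κ • v i - m • w‖ ^ 2 + ‖(1 - κ) • h j - (1 - m) • z‖ ^ 2) := by
  obtain ⟨hm0, hm1⟩ := hm
  obtain ⟨hκ0, hκ1⟩ := hκ
  have b1 := hv.mul_sub_le_norm hτ i hw hm0 hκ0
  have b2 := hh.mul_sub_le_norm hτ j hz (m := 1 - m) (κ := 1 - κ) (by linarith) (by linarith)
  have n1 := norm_nonneg (κ • v i - m • w)
  have n2 := norm_nonneg ((1 - κ) • h j - (1 - m) • z)
  set P := ‖κ • v i - m • w‖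
  set Q := ‖(1 - κ) • h j - (1 - m) • z‖
  constructor
  · rw [← mul_pow]
    rcases le_total m κ with hmκ | hmκ
    · have h0 : 0 ≤ τ * (κ - m) := mul_nonneg hτ (by linarith)
      have : (τ * (κ - m)) ^ 2 ≤ P ^ 2 := pow_le_pow_left₀ h0 (by linarith) 2
      nlinarith [sq_nonneg Q]
    · have h0 : 0 ≤ τ * (m - κ) := mul_nonneg hτ (by linarith)
      have : (τ * (m - κ)) ^ 2 ≤ Q ^ 2 := pow_le_pow_left₀ h0 (by linarith) 2
      nlinarith [sq_nonneg P]
  · intro hwτ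
    rw [← mul_pow]
    have h0 : 0 ≤ τ * κ := mul_nonneg hτ hκ0
    rcases le_total m (2 * κ) with hmκ | hmκ
    · have b3 : κ * ‖v i‖ - m * ‖w‖ ≤ P := by
        have := norm_sub_norm_le (κ • v i) (m • w)
        rwa [norm_smul, norm_smul, Real.norm_of_nonneg hκ0, Real.norm_of_nonneg hm0] at this
      have b4 : κ * (3 * τ) ≤ κ * ‖v i‖ := mul_le_mul_of_nonneg_left (hv.le_norm i) hκ0
      have b5 : m * ‖w‖ ≤ 2 * κ * τ := mul_le_mul hmκ hwτ.le (norm_nonneg _) (by positivity)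
      have : (τ * κ) ^ 2 ≤ P ^ 2 := pow_le_pow_left₀ h0 (by linarith) 2
      nlinarith [sq_nonneg Q]
    · have b3 : 0 ≤ τ * (m - 2 * κ) := mul_nonneg hτ (by linarith)
      have : (τ * κ) ^ 2 ≤ Q ^ 2 := pow_le_pow_left₀ h0 (by linarith) 2
      nlinarith [sq_nonneg P]

/-- The squared distances to the barycenter `(m • w, (1 - m) • z)` of the join are lowered
by `A` for the `v i` and by `B` for the `h j`, one of them negative. The first two conclusions keep
the variance inequality, the other three say that the corrected distances dominate the pairs
`v v`, `h h` and `v h`. -/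
theorem exists_joinCorrection {v : I → E} {h : J → F} {τ : ℝ} (hτ : 0 ≤ τ) (hv : IsSupported v τ)
    (hh : IsSupported h τ)
    (hseg : ∀ i i', ∀ κ ∈ Set.Icc (0 : ℝ) 1, 3 * τ ≤ ‖κ • v i + (1 - κ) • v i'‖)
    {w : E} (hw : w ∈ convexHull ℝ (Set.range v)) {z : F}
    (hz : z ∈ convexHull ℝ (Set.range h)) {m : ℝ} (hm : m ∈ Set.Icc (0 : ℝ) 1) :
    ∃ A B : ℝ, 0 ≤ (1 + m) * A + (1 - m) * B ∧ 0 ≤ m * A + (2 - m) * B ∧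
      (∀ i i', ∀ κ ∈ Set.Icc (0 : ℝ) 1, τ ^ 2 * (1 - m) ^ 2 + A ≤
        ‖κ • v i + (1 - κ) • v i' - m • w‖ ^ 2 + ‖(1 - m) • z‖ ^ 2) ∧
      τ ^ 2 * m ^ 2 + B ≤ ‖m • w‖ ^ 2 ∧
      ∀ i j, ∀ κ ∈ Set.Icc (0 : ℝ) 1, τ ^ 2 * (m - κ) ^ 2 + κ * A + (1 - κ) * B ≤
        ‖κ • v i - m • w‖ ^ 2 + ‖(1 - κ) • h j - (1 - m) • z‖ ^ 2 := by
  have hm0 := hm.1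
  have hm1 := hm.2
  have ew : ‖m • w‖ ^ 2 = m ^ 2 * ‖w‖ ^ 2 := by rw [norm_smul, mul_pow, Real.norm_eq_abs, sq_abs]
  have ez : ‖(1 - m) • z‖ ^ 2 = (1 - m) ^ 2 * ‖z‖ ^ 2 := by
    rw [norm_smul, mul_pow, Real.norm_eq_abs, sq_abs]
  rcases le_or_gt ‖m • w‖ (2 * τ) with hnear | hfar
  -- near the span of the `h j`, `‖w‖ < τ` would break the bound for two `h j`: raise those distances
  · obtain ⟨χ, hχ0, hχτ, hχw, hχ⟩ : ∃ χ : ℝ, 0 ≤ χ ∧ χ ≤ τ ^ 2 ∧ τ ^ 2 - ‖w‖ ^ 2 ≤ χ ∧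
        (χ = 0 ∨ ‖w‖ < τ) := by
      rcases le_or_gt τ ‖w‖ with h1 | h1
      · exact ⟨0, le_rfl, by positivity, by nlinarith, Or.inl rfl⟩
      · exact ⟨τ ^ 2 - ‖w‖ ^ 2, by nlinarith [norm_nonneg w], by nlinarith [norm_nonneg w],
          le_rfl, Or.inr h1⟩
    refine ⟨m * (2 - m) * χ, -(m ^ 2 * χ), ?_, ?_, ?_, ?_, ?_⟩
    · have : 0 ≤ m * χ := by positivity
      nlinarith
    · nlinarith
    · intro i i' κ hκ
      have b := norm_sub_norm_le (κ • v i + (1 - κ) • v i') (m • w)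
      have b' := hseg i i' κ hκ
      have b2 : τ ^ 2 ≤ ‖κ • v i + (1 - κ) • v i' - m • w‖ ^ 2 :=
        pow_le_pow_left₀ hτ (by linarith) 2
      have b3 : m * (2 - m) * χ ≤ m * (2 - m) * τ ^ 2 :=
        mul_le_mul_of_nonneg_left hχτ (mul_nonneg hm0 (by linarith))
      nlinarith [sq_nonneg ‖(1 - m) • z‖]
    · rw [ew]
      nlinarith [mul_le_mul_of_nonneg_left hχw (sq_nonneg m)]
    · intro i j κ hκ
      obtain ⟨c1, c2⟩ := joinSegment_bound hτ hv hh hw hz hm hκ i j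
      rcases hχ with rfl | hwτ
      · simpa using c1
      · have c3 := c2 hwτ
        -- the claim is the average of `c1` and `c3` with weights `τ ^ 2 - χ` and `χ`
        set R := ‖κ • v i - m • w‖ ^ 2 + ‖(1 - κ) • h j - (1 - m) • z‖ ^ 2
        have hτ2 : 0 < τ ^ 2 := by
          have : 0 < τ := (norm_nonneg w).trans_lt hwτ
          positivity
        refine le_of_mul_le_mul_left ?_ hτ2
        nlinarith [mul_le_mul_of_nonneg_left c1 (sub_nonneg.2 hχτ),
          mul_le_mul_of_nonneg_left c3 hχ0]
  -- away from it, `‖z‖ < τ` would break the bound for two `v i`: raise those distances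
  · obtain ⟨χ, hχ0, hχτ, hχz, hχ⟩ : ∃ χ : ℝ, 0 ≤ χ ∧ χ ≤ τ ^ 2 ∧ τ ^ 2 - ‖z‖ ^ 2 ≤ χ ∧
        (χ = 0 ∨ ‖z‖ < τ) := by
      rcases le_or_gt τ ‖z‖ with h1 | h1
      · exact ⟨0, le_rfl, by positivity, by nlinarith, Or.inl rfl⟩
      · exact ⟨τ ^ 2 - ‖z‖ ^ 2, by nlinarith [norm_nonneg z], by nlinarith [norm_nonneg z],
          le_rfl, Or.inr h1⟩
    have hm' : 0 ≤ 1 - m := by linarith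
    refine ⟨-((1 - m) ^ 2 * χ), (1 - m ^ 2) * χ, ?_, ?_, ?_, ?_, ?_⟩
    · nlinarith
    · have : 0 ≤ (1 - m) * χ := by positivity
      nlinarith
    · intro i i' κ hκ
      rw [ez]
      nlinarith [mul_le_mul_of_nonneg_left hχz (sq_nonneg (1 - m)),
        sq_nonneg ‖κ • v i + (1 - κ) • v i' - m • w‖]
    · have b1 : (2 * τ) ^ 2 ≤ ‖m • w‖ ^ 2 := pow_le_pow_left₀ (by positivity) hfar.le 2
      have b2 : (1 - m ^ 2) * χ ≤ (1 - m ^ 2) * τ ^ 2 :=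
        mul_le_mul_of_nonneg_left hχτ (by nlinarith)
      nlinarith [sq_nonneg τ]
    · intro i j κ hκ
      obtain ⟨c1, -⟩ := joinSegment_bound hτ hv hh hw hz hm hκ i j
      have hm'' : 1 - m ∈ Set.Icc (0 : ℝ) 1 := ⟨by linarith, by linarith⟩
      have hκ' : 1 - κ ∈ Set.Icc (0 : ℝ) 1 := ⟨by linarith [hκ.2], by linarith [hκ.1]⟩
      obtain ⟨-, c2⟩ := joinSegment_bound hτ hh hv hz hw hm'' hκ' j i
      simp only [sub_sub_cancel] at c2
      rcases hχ with rfl | hzτ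
      · simpa using c1
      · have c3 := c2 hzτ
        set P := ‖κ • v i - m • w‖ ^ 2
        set Q := ‖(1 - κ) • h j - (1 - m) • z‖ ^ 2
        have hτ2 : 0 < τ ^ 2 := by
          have : 0 < τ := (norm_nonneg z).trans_lt hzτ
          positivity
        refine le_of_mul_le_mul_left ?_ hτ2
        nlinarith [mul_le_mul_of_nonneg_left c1 (sub_nonneg.2 hχτ),
          mul_le_mul_of_nonneg_left c3 hχ0]

theorem sum_mul_norm_sub_sq [Fintype I] (v : I → E) (p : I → ℝ) (x : E) :
    ∑ i, p i * ‖v i - x‖ ^ 2 =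
      ∑ i, p i * ‖v i‖ ^ 2 - 2 * inner ℝ (∑ i, p i • v i) x + (∑ i, p i) * ‖x‖ ^ 2 := by
  rw [sum_inner, Finset.mul_sum, Finset.sum_mul, ← Finset.sum_sub_distrib,
    ← Finset.sum_add_distrib]
  refine Finset.sum_congr rfl fun i _ => ?_
  rw [norm_sub_sq_real, real_inner_smul_left]
  ring

/-- The identity `κ‖x-ζ‖² + (1-κ)‖y-ζ‖² - κ(1-κ)‖x-y‖² = ‖κx + (1-κ)y - ζ‖²`. -/
theorem norm_segment_sub_sq (x y ζ : E) (κ : ℝ) :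
    ‖κ • x + (1 - κ) • y - ζ‖ ^ 2 =
      κ * ‖x - ζ‖ ^ 2 + (1 - κ) * ‖y - ζ‖ ^ 2 - κ * (1 - κ) * ‖x - y‖ ^ 2 := by
  have e1 : κ • x + (1 - κ) • y - ζ = κ • (x - ζ) + (1 - κ) • (y - ζ) := by module
  have e2 : x - y = (x - ζ) - (y - ζ) := by abel
  rw [e1, e2, norm_add_sq_real, norm_sub_sq_real (x - ζ), norm_smul, norm_smul,
    real_inner_smul_left, real_inner_smul_right, mul_pow, mul_pow, Real.norm_eq_abs,
    Real.norm_eq_abs, sq_abs, sq_abs]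
  ring

theorem hasVirtualBarycenters_join [Fintype I] [Fintype J] [Nonempty I] [Nonempty J]
    {v : I → E} {h : J → F} {τ : ℝ} (hτ : 0 ≤ τ) (hv : IsSupported v τ)
    (hh : IsSupported h τ)
    (hseg : ∀ i i', ∀ κ ∈ Set.Icc (0 : ℝ) 1, 3 * τ ≤ ‖κ • v i + (1 - κ) • v i'‖) :
    HasVirtualBarycenters (joinSqDist v h τ) := by
  intro p hp hp1
  rw [Fintype.sum_sum_type] at hp1
  obtain ⟨w, hw, hζ⟩ := exists_smul_eq_sum_of_nonneg v (p := fun i => p (.inl i)) fun i => hp _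
  obtain ⟨z, hz, hη⟩ := exists_smul_eq_sum_of_nonneg h (p := fun j => p (.inr j)) fun i => hp _
  have hm0 : 0 ≤ ∑ i, p (.inl i) := Finset.sum_nonneg fun i _ => hp _
  have hn0 : 0 ≤ ∑ j, p (.inr j) := Finset.sum_nonneg fun i _ => hp _
  have sv := sum_mul_norm_sub_sq v fun i => p (.inl i)
  have sh := sum_mul_norm_sub_sq h fun j => p (.inr j)
  set m := ∑ i, p (.inl i) with hm
  have hn : ∑ j, p (.inr j) = 1 - m := by linarith
  rw [hn] at hη hn0 sh
  obtain ⟨A, B, hA, hB, hvv, hhh, hvh⟩ :=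
    exists_joinCorrection hτ hv hh hseg hw hz (m := m) ⟨hm0, by linarith⟩
  rw [hζ] at sv
  rw [hη] at sh
  set ζ := m • w
  set η := (1 - m) • z
  set Sv := ∑ i, p (.inl i) * ‖v i‖ ^ 2
  set Sh := ∑ j, p (.inr j) * ‖h j‖ ^ 2
  set u : I ⊕ J → ℝ := Sum.elim
    (fun i => ‖v i - ζ‖ ^ 2 + ‖η‖ ^ 2 - τ ^ 2 * (1 - m) ^ 2 - A)
    (fun j => ‖h j - η‖ ^ 2 + ‖ζ‖ ^ 2 - τ ^ 2 * m ^ 2 - B) with hu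
  have hsum : ∑ k, p k * u k = Sv + Sh - ‖ζ‖ ^ 2 - ‖η‖ ^ 2 - m * (1 - m) * τ ^ 2
      - m * A - (1 - m) * B := by
    have e1 : ∑ i, p (.inl i) * u (.inl i) =
        ∑ i, p (.inl i) * ‖v i - ζ‖ ^ 2 + m * (‖η‖ ^ 2 - τ ^ 2 * (1 - m) ^ 2 - A) := by
      rw [hm, Finset.sum_mul, ← Finset.sum_add_distrib]
      exact Finset.sum_congr rfl fun i _ => by simp only [hu, Sum.elim_inl]; ring
    have e2 : ∑ j, p (.inr j) * u (.inr j) =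
        ∑ j, p (.inr j) * ‖h j - η‖ ^ 2 + (1 - m) * (‖ζ‖ ^ 2 - τ ^ 2 * m ^ 2 - B) := by
      rw [← hn, Finset.sum_mul, ← Finset.sum_add_distrib]
      exact Finset.sum_congr rfl fun i _ => by simp only [hu, Sum.elim_inr]; ring
    rw [Fintype.sum_sum_type, e1, e2, sv, sh, real_inner_self_eq_norm_sq,
      real_inner_self_eq_norm_sq]
    ring
  have cross : ∀ i j, ∀ κ ∈ Set.Icc (0 : ℝ) 1,
      κ * (1 - κ) * (‖v i‖ ^ 2 + ‖h j‖ ^ 2 - τ ^ 2) ≤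
        κ * u (.inl i) + (1 - κ) * u (.inr j) := by
    intro i j κ hκ
    have := hvh i j κ hκ
    have e1 := norm_segment_sub_sq (v i) 0 ζ κ
    have e2 := norm_segment_sub_sq 0 (h j) η κ
    simp only [smul_zero, add_zero, zero_add, zero_sub, sub_zero, norm_neg] at e1 e2
    simp only [hu, Sum.elim_inl, Sum.elim_inr]
    rw [e1, e2] at this
    linear_combination this
  refine ⟨u, ?_, ?_⟩
  · rintro (i | j) (i' | j') κ hκ
    · have := hvv i i' κ hκ
      rw [norm_segment_sub_sq] at this
      simp only [hu, joinSqDist, Sum.elim_inl]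
      linear_combination this
    · exact cross i j' κ hκ
    · have := cross i' j (1 - κ) ⟨by linarith [hκ.2], by linarith [hκ.1]⟩
      simp only [joinSqDist]
      linear_combination this
    · have := norm_segment_sub_sq (h j) (h j') η κ
      have hsq := sq_nonneg ‖κ • h j + (1 - κ) • h j' - η‖
      simp only [hu, joinSqDist, Sum.elim_inr]
      linear_combination hhh + hsq + this
  · rintro (i | j)
    · rw [hsum, Fintype.sum_sum_type]
      simp only [joinSqDist, hu, Sum.elim_inl]
      have e : ∑ j, p (.inr j) * (‖v i‖ ^ 2 + ‖h j‖ ^ 2 - τ ^ 2) =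
          (1 - m) * (‖v i‖ ^ 2 - τ ^ 2) + Sh := by
        rw [← hn, Finset.sum_mul, ← Finset.sum_add_distrib]
        exact Finset.sum_congr rfl fun j _ => by ring
      rw [e, sv, norm_sub_sq_real, real_inner_comm]
      linear_combination hA
    · rw [hsum, Fintype.sum_sum_type]
      simp only [joinSqDist, hu, Sum.elim_inr]
      have e : ∑ i, p (.inl i) * (‖v i‖ ^ 2 + ‖h j‖ ^ 2 - τ ^ 2) =
          m * (‖h j‖ ^ 2 - τ ^ 2) + Sv := by
        rw [hm, Finset.sum_mul, ← Finset.sum_add_distrib]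
        exact Finset.sum_congr rfl fun j _ => by ring
      rw [e, sh, norm_sub_sq_real, real_inner_comm]
      linear_combination hB

end Join

theorem joinSqDist_pos {E F I J : Type*} [NormedAddCommGroup E] [InnerProductSpace ℝ E]
    [NormedAddCommGroup F] {v : I → E} {h : J → F} {τ : ℝ} (hτ : 0 < τ) (hv : IsSupported v τ)
    (hvi : Function.Injective v) (hhi : Function.Injective h) {k l : I ⊕ J} (hkl : k ≠ l) :
    0 < joinSqDist v h τ k l := by
  have cross : ∀ i j, 0 < ‖v i‖ ^ 2 + ‖h j‖ ^ 2 - τ ^ 2 := fun i j => by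
    nlinarith [hv.le_norm i, sq_nonneg ‖h j‖]
  rcases k with i | j <;> rcases l with i' | j'
  · exact pow_pos (norm_pos_iff.2 (sub_ne_zero.2 fun e => hkl (congrArg _ (hvi e)))) 2
  · exact cross i j'
  · exact cross i' j
  · exact pow_pos (norm_pos_iff.2 (sub_ne_zero.2 fun e => hkl (congrArg _ (hhi e)))) 2

/-! ### A quadrilateral, a crossing segment, and the six-point inequality -/

/-- `IsSupported` holds for small `τ` if at each `v i` a linear functional attains its maximum over
the configuration, with value `1`. -/
theorem eventually_isSupported {E I : Type*} [NormedAddCommGroup E] [InnerProductSpace ℝ E]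
    [Finite I] (v : I → E)
    (hv : ∀ i, ∃ ℓ : E →L[ℝ] ℝ, ℓ (v i) = 1 ∧ ∀ j, ℓ (v j) ≤ 1) :
    ∀ᶠ τ in 𝓝[>] (0 : ℝ), IsSupported v τ := by
  refine Filter.eventually_all.2 fun i => ?_
  obtain ⟨ℓ, h1, h2⟩ := hv i
  have hev : ∀ᶠ τ in 𝓝 (0 : ℝ), ‖ℓ‖ * (3 * τ) < 1 := by
    have : Filter.Tendsto (fun τ : ℝ => ‖ℓ‖ * (3 * τ)) (𝓝 0) (𝓝 (‖ℓ‖ * (3 * 0))) :=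
      Continuous.tendsto (by fun_prop) 0
    exact this.eventually_lt_const (by simp)
  filter_upwards [nhdsWithin_le_nhds hev, self_mem_nhdsWithin] with τ hτ hτ0 w hw m hm
  rw [Set.mem_Ioi] at hτ0
  have hw1 : ℓ w ≤ 1 := by
    have hc : Convex ℝ {x | ℓ x ≤ 1} := convex_halfSpace_le ℓ.isLinear 1
    exact convexHull_min (by rintro _ ⟨j, rfl⟩; exact h2 j) hc hw
  have h3 : 1 - m ≤ ‖ℓ‖ * ‖v i - m • w‖ := by
    have h := (le_abs_self _).trans (ℓ.le_opNorm (v i - m • w))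
    rw [map_sub, map_smul, h1, smul_eq_mul] at h
    nlinarith [hm.1]
  have h4 : 0 ≤ 3 * τ := by positivity
  calc 3 * τ * (1 - m) ≤ 3 * τ * (‖ℓ‖ * ‖v i - m • w‖) := mul_le_mul_of_nonneg_left h3 h4
    _ = (‖ℓ‖ * (3 * τ)) * ‖v i - m • w‖ := by ring
    _ ≤ 1 * ‖v i - m • w‖ := mul_le_mul_of_nonneg_right hτ.le (norm_nonneg _)
    _ = _ := one_mul _

theorem eventually_le_norm_segment {E I : Type*} [NormedAddCommGroup E] [InnerProductSpace ℝ E]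
    [Finite I] (v : I → E)
    (hv : ∀ i j, ∃ ℓ : E →L[ℝ] ℝ, 0 < ℓ (v i) ∧ 0 < ℓ (v j)) :
    ∀ᶠ τ in 𝓝[>] (0 : ℝ), ∀ i j, ∀ κ ∈ Set.Icc (0 : ℝ) 1,
      3 * τ ≤ ‖κ • v i + (1 - κ) • v j‖ := by
  refine Filter.eventually_all.2 fun i => Filter.eventually_all.2 fun j => ?_
  obtain ⟨ℓ, h1, h2⟩ := hv i j
  have hmin : 0 < min (ℓ (v i)) (ℓ (v j)) := lt_min h1 h2
  have hev : ∀ᶠ τ in 𝓝 (0 : ℝ), ‖ℓ‖ * (3 * τ) < min (ℓ (v i)) (ℓ (v j)) := by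
    have : Filter.Tendsto (fun τ : ℝ => ‖ℓ‖ * (3 * τ)) (𝓝 0) (𝓝 (‖ℓ‖ * (3 * 0))) :=
      Continuous.tendsto (by fun_prop) 0
    exact this.eventually_lt_const (by simpa using hmin)
  filter_upwards [nhdsWithin_le_nhds hev] with τ hτ κ hκ
  have h3 : min (ℓ (v i)) (ℓ (v j)) ≤ ‖ℓ‖ * ‖κ • v i + (1 - κ) • v j‖ := by
    have h := (le_abs_self _).trans (ℓ.le_opNorm (κ • v i + (1 - κ) • v j))
    rw [map_add, map_smul, map_smul, smul_eq_mul, smul_eq_mul] at h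
    nlinarith [hκ.1, hκ.2, min_le_left (ℓ (v i)) (ℓ (v j)), min_le_right (ℓ (v i)) (ℓ (v j))]
  exact (lt_of_mul_lt_mul_left (hτ.trans_le h3) (norm_nonneg _)).le

/-- The points `x₀, x₁, y₀, y₁`, in this order: the vertices of a quadrilateral whose
perpendicular diagonals `x₀x₁` and `y₀y₁` have length one and are divided by their common point in
the ratios `a : 1 - a` and `b : 1 - b`. The coordinates are relative to the point
`(1 - t) y₁ + t ((1 - s) x₀ + s x₁)`, which becomes the origin. -/
noncomputable def quadrilateral (a b s t : ℝ) : Fin 4 → ℂ :=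
  ![⟨-a - t * (s - a), -((1 - t) * (1 - b))⟩, ⟨1 - a - t * (s - a), -((1 - t) * (1 - b))⟩,
    ⟨-(t * (s - a)), -b - (1 - t) * (1 - b)⟩, ⟨-(t * (s - a)), 1 - b - (1 - t) * (1 - b)⟩]

/-- The points `z₀, z₁` of a line orthogonal to the plane of the quadrilateral; they span a segment
of length one that meets this plane in the origin. -/
def crossingSegment (c : ℝ) : Fin 2 → ℝ := ![-c, 1 - c]

section Parameters

variable {a b c s t : ℝ}

theorem exists_support_crossingSegment (hc : c ∈ Set.Ioo (0 : ℝ) 1) (i : Fin 2) :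
    ∃ ℓ : ℝ →L[ℝ] ℝ, ℓ (crossingSegment c i) = 1 ∧ ∀ j, ℓ (crossingSegment c j) ≤ 1 := by
  obtain ⟨h0, h1⟩ := hc
  have h1' : 0 < 1 - c := by linarith
  refine ⟨(crossingSegment c i)⁻¹ • ContinuousLinearMap.id ℝ ℝ, ?_, ?_⟩ <;>
    fin_cases i <;>
    simp [Fin.forall_fin_two, crossingSegment, inv_mul_eq_div, h0.ne', h1'.ne', neg_div]
  · linarith [div_nonneg h1'.le h0.le]
  · linarith [div_nonneg h0.le h1'.le]

theorem exists_support_quadrilateral (ha : a ∈ Set.Ioo (0 : ℝ) 1) (hb : b ∈ Set.Ioo (0 : ℝ) 1)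
    (hs : s ∈ Set.Ioo (0 : ℝ) 1) (ht : t ∈ Set.Ioo (0 : ℝ) 1) (has : a < s) (i : Fin 4) :
    ∃ ℓ : ℂ →L[ℝ] ℝ, ℓ (quadrilateral a b s t i) = 1 ∧
      ∀ j, ℓ (quadrilateral a b s t j) ≤ 1 := by
  obtain ⟨ha0, ha1⟩ := ha
  obtain ⟨hb0, hb1⟩ := hb
  obtain ⟨hs0, hs1⟩ := hs
  obtain ⟨ht0, ht1⟩ := ht
  have key : ∀ α β K : ℝ, 0 < K →
      α * (quadrilateral a b s t i).re + β * (quadrilateral a b s t i).im = K →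
      (∀ j, α * (quadrilateral a b s t j).re + β * (quadrilateral a b s t j).im ≤ K) →
      ∃ ℓ : ℂ →L[ℝ] ℝ, ℓ (quadrilateral a b s t i) = 1 ∧
        ∀ j, ℓ (quadrilateral a b s t j) ≤ 1 := by
    intro α β K hK h1 h2
    refine ⟨K⁻¹ • (α • Complex.reCLM + β • Complex.imCLM), ?_, fun j => ?_⟩
    · simp [← mul_add, h1, hK.ne']
    · have := mul_le_mul_of_nonneg_left (h2 j) (inv_nonneg.2 hK.le)
      rw [inv_mul_cancel₀ hK.ne'] at this
      simpa [← mul_add] using this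
  have w1 : 0 < t * (s - a) := mul_pos ht0 (by linarith)
  have w2 : 0 < (1 - t) * (1 - b) := mul_pos (by linarith) (by linarith)
  -- the line `x₀y₀` supports at `x₀` and `y₀`, the line `x₁y₁` at `x₁` and `y₁`
  have hK₀ : 0 < a * b + b * (t * (s - a)) + a * ((1 - t) * (1 - b)) := by positivity
  have hK₁ : 0 < (1 - b) * (t * (1 - s)) :=
    mul_pos (by linarith) (mul_pos ht0 (by linarith))
  fin_cases i
  · refine key (-b) (-a) _ hK₀ ?_ ?_
    · simp [quadrilateral]; ring
    · simp [Fin.forall_fin_succ, quadrilateral]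
      refine ⟨?_, ?_, ?_, ?_⟩ <;> linarith
  · refine key (1 - b) (1 - a) _ hK₁ ?_ ?_
    · simp [quadrilateral]; ring
    · simp [Fin.forall_fin_succ, quadrilateral]
      refine ⟨?_, ?_, ?_, ?_⟩ <;> linarith
  · refine key (-b) (-a) _ hK₀ ?_ ?_
    · simp [quadrilateral]; ring
    · simp [Fin.forall_fin_succ, quadrilateral]
      refine ⟨?_, ?_, ?_, ?_⟩ <;> linarith
  · refine key (1 - b) (1 - a) _ hK₁ ?_ ?_
    · simp [quadrilateral]; ring
    · simp [Fin.forall_fin_succ, quadrilateral]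
      refine ⟨?_, ?_, ?_, ?_⟩ <;> linarith

/-- The origin lies on no segment between two vertices: it is above the line `x₀x₁`, to the right
of the line `y₀y₁`, and on the inner side of the line `x₁y₁`. -/
theorem exists_separation_quadrilateral (ha : a ∈ Set.Ioo (0 : ℝ) 1)
    (hb : b ∈ Set.Ioo (0 : ℝ) 1) (hs : s ∈ Set.Ioo (0 : ℝ) 1) (ht : t ∈ Set.Ioo (0 : ℝ) 1)
    (has : a < s) (i j : Fin 4) :
    ∃ ℓ : ℂ →L[ℝ] ℝ, 0 < ℓ (quadrilateral a b s t i) ∧ 0 < ℓ (quadrilateral a b s t j) := by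
  obtain ⟨ha0, ha1⟩ := ha
  obtain ⟨hb0, hb1⟩ := hb
  obtain ⟨hs0, hs1⟩ := hs
  obtain ⟨ht0, ht1⟩ := ht
  have w1 : 0 < t * (s - a) := mul_pos ht0 (by linarith)
  have w2 : 0 < (1 - t) * (1 - b) := mul_pos (by linarith) (by linarith)
  have hK₁ : 0 < (1 - b) * (t * (1 - s)) :=
    mul_pos (by linarith) (mul_pos ht0 (by linarith))
  have him : ∀ k : Fin 4, k ≠ 3 → 0 < (-Complex.imCLM) (quadrilateral a b s t k) := by
    intro k hk
    fin_cases k <;> simp [quadrilateral] at hk ⊢ <;> linarith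
  have hre : ∀ k : Fin 4, k ≠ 1 → 0 < (-Complex.reCLM) (quadrilateral a b s t k) := by
    intro k hk
    fin_cases k <;> simp [quadrilateral] at hk ⊢ <;> linarith
  have hx₁y₁ : ∀ k : Fin 4, k = 1 ∨ k = 3 →
      0 < ((1 - b) • Complex.reCLM + (1 - a) • Complex.imCLM) (quadrilateral a b s t k) := by
    rintro k (rfl | rfl) <;> simp [quadrilateral] <;> linarith
  by_cases h3 : i ≠ 3 ∧ j ≠ 3
  · exact ⟨_, him i h3.1, him j h3.2⟩
  by_cases h1 : i ≠ 1 ∧ j ≠ 1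
  · exact ⟨_, hre i h1.1, hre j h1.2⟩
  · exact ⟨_, hx₁y₁ i (by omega), hx₁y₁ j (by omega)⟩

theorem quadrilateral_injective (ha : a ∈ Set.Ioo (0 : ℝ) 1) (hb : b ∈ Set.Ioo (0 : ℝ) 1) :
    Function.Injective (quadrilateral a b s t) := by
  obtain ⟨ha0, ha1⟩ := ha
  obtain ⟨hb0, hb1⟩ := hb
  intro i j h
  have hre := congrArg Complex.re h
  have him := congrArg Complex.im h
  fin_cases i <;> fin_cases j <;> simp [quadrilateral] at hre him ⊢ <;> linarith

theorem crossingSegment_injective : Function.Injective (crossingSegment c) := by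
  intro i j h
  fin_cases i <;> fin_cases j <;> simp [crossingSegment] at h ⊢
  all_goals linarith

end Parameters

theorem corollary1p5 (a b c s t : ℝ)
    (ha : a ∈ Set.Ioo (0 : ℝ) 1) (hb : b ∈ Set.Ioo (0 : ℝ) 1) (hc : c ∈ Set.Ioo (0 : ℝ) 1)
    (hs : s ∈ Set.Ioo (0 : ℝ) 1) (ht : t ∈ Set.Ioo (0 : ℝ) 1) (has : a < s) :
    ∃ (L : Type) (_ : MetricSpace L), Nat.card L = 6 ∧
      SatisfiesANNInequalities L ∧ ¬ SatisfiesSixPointInequality L a b c s t := by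
  obtain ⟨τ, hv, hh, hseg, hτ⟩ := ((eventually_isSupported (quadrilateral a b s t)
    (exists_support_quadrilateral ha hb hs ht has)).and
    ((eventually_isSupported (crossingSegment c) (exists_support_crossingSegment hc)).and
    ((eventually_le_norm_segment (quadrilateral a b s t)
      (exists_separation_quadrilateral ha hb hs ht has)).and
      (self_mem_nhdsWithin : ∀ᶠ τ in 𝓝[>] (0 : ℝ), 0 < τ)))).exists
  have hD := hasVirtualBarycenters_join hτ.le hv hh hseg
  obtain ⟨inst, hdist⟩ := hD.exists_metricSpace
    (by rintro (i | j) <;> simp [joinSqDist])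
    (by rintro (i | j) (i' | j') <;> simp [joinSqDist, norm_sub_rev])
    fun i j => joinSqDist_pos hτ hv (quadrilateral_injective ha hb) crossingSegment_injective
  refine ⟨Fin 4 ⊕ Fin 2, inst, by simp, satisfiesANNInequalities_of_hasVirtualBarycenters hD hdist,
    fun h6 => ?_⟩
  have h := h6 (.inl 0) (.inl 1) (.inl 2) (.inl 3) (.inr 0) (.inr 1)
  simp only [hdist, joinSqDist, Complex.sq_norm, Complex.normSq_apply, Real.norm_eq_abs, sq_abs,
    Complex.sub_re, Complex.sub_im] at h
  simp [quadrilateral, crossingSegment] at h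
  have hpos : 0 < a * b * τ ^ 2 := mul_pos (mul_pos ha.1 hb.1) (pow_pos hτ 2)
  -- the two sides differ by exactly `a * b * τ ^ 2`
  nlinarith
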